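/- Let $T$ be the set of all terms built from one variable $x$ and one binary operation symbol $*$, and let $=_{LD}$ be the least congruence on $T$ that contains all pairs $\big(t_1*(t_2*t_3),\,(t_1*t_2)*(t_1*t_3)\big)$. View terms as binary trees, and call finite sequences of $0$ (left) and $1$ (right) addresses. For $t$ in $T$ and a finite sequence $s$ of addresses, let $\mathrm{EXPAND}(t,s)$ be the term obtained from $t$ by successively replacing, for each address $\alpha$ in $s$ from the first to the last, the subterm at address $\alpha$, which must exist and have the form $t_1*(t_2*t_3)$, with $(t_1*t_2)*(t_1*t_3)$; it is undefined if one of these steps is impossible. Write $t\sqsubset t'$ if $t$ is a proper iterated left subterm of $t'$, that is, if $t'=(\cdots((t*u_1)*u_2)\cdots)*u_k$ for some $k\ge 1$ and some terms $u_1,\dots,u_k$. Given an enumeration $(s_n,s'_n)_{n\ge 0}$ of pairs of finite sequences of addresses, consider the following algorithm with input $(t,t')\in T\times T$: for $n=0,1,2,\dots$, compute $t_1=\mathrm{EXPAND}(t,s_n)$ and $t'_1=\mathrm{EXPAND}(t',s'_n)$; if both are defined and $t_1=t'_1$, stop and return True; if both are defined and $t_1\sqsubset t'_1$ or $t'_1\sqsubset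 t_1$, stop and return False; otherwise pass to $n+1$. Then, without any set-theoretic assumption: (i) for every exhaustive enumeration $(s_n,s'_n)_{n\ge0}$ of the pairs of finite sequences of addresses (every pair occurs at least once), the algorithm is correct: for all $t,t'$ in $T$ it terminates, and it returns True if $t=_{LD}t'$ and False otherwise; (ii) whenever the enumeration is computable, the (partial) function of $(t,t')$ computed by the algorithm is partial recursive; (iii) the word problem of left selfdistributivity is decidable in the case of one variable: the relation $=_{LD}$ on $T$ is a computable (recursive) relation. -/

import Mathlib

namespace SelfDistrib

/-- Terms over a set `X` of variables, built with one binary operation: the absolutely free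
algebra. Its elements are binary trees with leaves labelled in `X`. -/
abbrev Term (X : Type*) := FreeMagma X

/-- Terms in one variable. -/
abbrev Term₁ := Term Unit

/-- The instances of the left selfdistributive law. -/
inductive LDInstance (X : Type*) : Term X → Term X → Prop
  | intro (t₁ t₂ t₃ : Term X) : LDInstance X (t₁ * (t₂ * t₃)) ((t₁ * t₂) * (t₁ * t₃))

/-- LD-equivalence: the congruence generated by the instances of the law LD. -/
def ldCon (X : Type*) : Con (Term X) := conGen (LDInstance X)

/-- `a` divides `b` if `a * x = b` for some `x`. -/
def Divides {S : Type*} [Mul S] (a b : S) : Prop := ∃ x, a * x = b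

/-- The transitive closure of the division relation. On terms, `IterDivides s t` says that `s` is a
proper iterated left subterm of `t`. -/
def IterDivides {S : Type*} [Mul S] : S → S → Prop := Relation.TransGen Divides

/-- Effective test for `IterDivides` on terms: look for `s` among the iterated left subterms. -/
def iterDividesTest {X : Type*} [DecidableEq X] (s : Term X) : Term X → Bool
  | .of _ => false
  | .mul a _ => decide (s = a) || iterDividesTest s a

theorem iterDividesTest_iff {X : Type*} [DecidableEq X] (s t : Term X) :
    iterDividesTest s t = true ↔ IterDivides s t := by
  constructor
  · intro h
    induction t with
    | of x => simp [iterDividesTest] at h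
    | mul a b iha _ =>
      have h' : s = a ∨ iterDividesTest s a = true := by
        change (decide (s = a) || iterDividesTest s a) = true at h
        simpa using h
      rcases h' with rfl | h'
      · exact Relation.TransGen.single ⟨b, rfl⟩
      · exact Relation.TransGen.tail (iha h') ⟨b, rfl⟩
  · intro h
    induction h with
    | single h =>
      obtain ⟨x, rfl⟩ := h
      change (decide (s = s) || iterDividesTest s s) = true
      simp
    | @tail b c _ h ih =>
      obtain ⟨x, rfl⟩ := h
      change (decide (s = b) || iterDividesTest s b) = true
      simp [ih]

instance {X : Type*} [DecidableEq X] (s t : Term X) : Decidable (IterDivides s t) :=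
  decidable_of_iff _ (iterDividesTest_iff s t)

/-- Addresses of nodes in binary trees: `false` means left, `true` means right. -/
abbrev Address := List Bool

/-- Apply the law LD once in the expanding direction at a given address: the subterm at that
address must exist and have the form `t₁ * (t₂ * t₃)`, and it is replaced with
`(t₁ * t₂) * (t₁ * t₃)`; otherwise the result is undefined (`none`). -/
def expandAt {X : Type*} : Address → Term X → Option (Term X)
  | [], .mul t₁ (.mul t₂ t₃) => some ((t₁ * t₂) * (t₁ * t₃))
  | false :: α, .mul a b => (expandAt α a).map fun a' => a' * b
  | true :: α, .mul a b => (expandAt α b).map fun b' => a * b'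
  | _, _ => none

/-- Apply LD in the expanding direction successively at each address of a finite sequence, from
the first to the last; undefined as soon as one of the steps is undefined. -/
def expand {X : Type*} (t : Term X) (s : List Address) : Option (Term X) :=
  s.foldlM (fun t' α => expandAt α t') t

/-- One pass through the loop of the algorithm, for a pair of sequences of addresses: expand both
terms accordingly; return `true` if the results are equal, `false` if one result is a proper
iterated left subterm of the other. If nothing is returned (`none`), the loop continues. -/
def pass (t t' : Term₁) (p : List Address × List Address) : Option Bool :=
  match expand t p.1, expand t' p.2 with
  | some t₁, some t₁' =>
    if t₁ = t₁' then some true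
    else if IterDivides t₁ t₁' ∨ IterDivides t₁' t₁ then some false
    else none
  | _, _ => none

/-- The syntactic algorithm, relative to an enumeration `e` of the pairs of sequences of addresses:
run the passes for `e 0`, `e 1`, `e 2`, ... and return the answer of the first pass that returns
one. The value is undefined when the loop runs forever. -/
def syntacticAlgorithm (e : ℕ → List Address × List Address) (t t' : Term₁) : Part Bool :=
  Nat.rfindOpt fun n => pass t t' (e n)

/-- The Gödel number of a term in one variable. -/
def termCode : Term₁ → ℕ
  | .of _ => 0
  | .mul a b => Nat.pair (termCode a) (termCode b) + 1

/-- The term in one variable with a given Gödel number. -/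
def termDecode : ℕ → Term₁
  | 0 => .of ()
  | n + 1 => termDecode n.unpair.1 * termDecode n.unpair.2
decreasing_by
  · exact Nat.lt_succ_of_le (Nat.unpair_left_le n)
  · exact Nat.lt_succ_of_le (Nat.unpair_right_le n)

theorem termDecode_termCode (t : Term₁) : termDecode (termCode t) = t := by
  induction t with
  | of x => simp [termCode, termDecode]
  | mul a b iha ihb =>
    change termDecode (Nat.pair (termCode a) (termCode b) + 1) = a * b
    rw [termDecode, Nat.unpair_pair, iha, ihb]

theorem termCode_termDecode (n : ℕ) : termCode (termDecode n) = n := by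
  induction n using Nat.strong_induction_on with
  | _ n ih =>
    cases n with
    | zero => simp [termCode, termDecode]
    | succ n =>
      rw [termDecode]
      change Nat.pair (termCode (termDecode n.unpair.1)) (termCode (termDecode n.unpair.2)) + 1
        = n + 1
      rw [ih _ (Nat.lt_succ_of_le (Nat.unpair_left_le n)),
        ih _ (Nat.lt_succ_of_le (Nat.unpair_right_le n)), Nat.pair_unpair]

/-- Terms in one variable are coded by natural numbers, so that computability makes sense. -/
instance : Primcodable Term₁ :=
  Primcodable.ofEquiv ℕ ⟨termCode, termDecode, termDecode_termCode, termCode_termDecode⟩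

end SelfDistrib

/-!
The algorithm is correct because of three facts on LD-equivalence.

*Confluence* (`LDExpands.confluent`, `exists_common_expansion`). Every term `t` has a derivative
`∂t`, an expansion of `t` that is also an expansion of all terms obtained from `t` by one step
(`LDStep.ldExpands_derivative`), and `∂` preserves expansion (`LDExpands.derivative`). So two
expansions of a term have a common expansion, and LD-equivalent terms have a common expansion.

*Comparison in one variable* (`exists_comparable_expansions`). Large right powers
`x * (x * (⋯ * x))` absorb all terms: `t * xⁿ` is LD-equivalent to `xⁿ⁺¹`, for every `t` and all large
`n` (`exists_absorption`). Hence `t * xⁿ` and `t' * xⁿ` have a common expansion. Expanding a term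
expands its iterated left subterms, so expansions of `t` and of `t'` both appear among the iterated
left subterms of one term, where any two are equal or one is an iterated left subterm of the other.
The loop therefore stops as soon as the corresponding pair of sequences is enumerated.

*Acyclicity* (`IterDivides.not_ldCon`). A term is never LD-equivalent to a proper iterated left
subterm of itself, so the answer `false` is right. It suffices to find one selfdistributive
structure where this holds. On the automorphisms of a free group on `x₀, x₁, …`, the operation
`a * b = a · sh b · σ · (sh a)⁻¹` is selfdistributive, where `sh` is the shift and `σ` is Artin's
automorphism `x₀ ↦ x₀ x₁ x₀⁻¹`, `x₁ ↦ x₀`. When `t` is a proper iterated left subterm of `t'`, the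
quotient of their values is a product of factors `sh b · σ · sh a`. Following Larue, both `σ` and the
shifted automorphisms preserve the set of reduced words that begin with `x₀`
(`StartsWith.artin`, `StartsWith.shift`), and `σ` maps `x₀⁻¹` into this set, so such a product is not
the identity.

One pass of the loop is primitive recursive (`primrec_pass`), so the algorithm is partial recursive
when the enumeration is computable. Applied to a computable exhaustive enumeration, it decides
LD-equivalence.
-/

namespace SelfDistrib

/-! ### Expansions and confluence -/

section Expansion

variable {X : Type*}

theorem mul_injective {a b c d : Term X} (h : a * b = c * d) : a = c ∧ b = d := by
  cases h
  exact ⟨rfl, rfl⟩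

theorem termInduction {P : Term X → Prop} (of : ∀ x, P (.of x))
    (mul : ∀ a b, P a → P b → P (a * b)) (t : Term X) : P t :=
  FreeMagma.recOnMul t of mul

/-- One application of the law LD in the expanding direction, at an arbitrary node. -/
inductive LDStep : Term X → Term X → Prop
  | root (a b c : Term X) : LDStep (a * (b * c)) ((a * b) * (a * c))
  | left {a a' : Term X} (b : Term X) : LDStep a a' → LDStep (a * b) (a' * b)
  | right (a : Term X) {b b' : Term X} : LDStep b b' → LDStep (a * b) (a * b')

/-- `LDExpands t t'`: the term `t'` is obtained from `t` by finitely many expansion steps. -/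
abbrev LDExpands : Term X → Term X → Prop := Relation.ReflTransGen LDStep

theorem LDExpands.mul {a a' b b' : Term X} (ha : LDExpands a a') (hb : LDExpands b b') :
    LDExpands (a * b) (a' * b') :=
  (Relation.ReflTransGen.lift (· * b) (fun _ _ h => LDStep.left b h) _ _ ha).trans
    (Relation.ReflTransGen.lift (a' * ·) (fun _ _ h => LDStep.right a' h) _ _ hb)

/-- Substitution: the term obtained from `t` by replacing each leaf `x` with the term `f x`. -/
def subst (f : X → Term X) : Term X → Term X
  | .of x => f x
  | .mul a b => subst f a * subst f b

@[simp] theorem subst_of (f : X → Term X) (x : X) : subst f (.of x) = f x := rfl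

@[simp] theorem subst_mul (f : X → Term X) (a b : Term X) :
    subst f (a * b) = subst f a * subst f b := rfl

theorem subst_subst (f g : X → Term X) (t : Term X) :
    subst f (subst g t) = subst (fun x => subst f (g x)) t := by
  induction t using termInduction with
  | of x => rfl
  | mul a b iha ihb => simp [iha, ihb]

theorem LDStep.subst (f : X → Term X) {t t' : Term X} (h : LDStep t t') :
    LDStep (SelfDistrib.subst f t) (SelfDistrib.subst f t') := by
  induction h with
  | root a b c => exact .root _ _ _
  | left b _ ih => exact .left _ ih
  | right a _ ih => exact .right _ ih

theorem LDExpands.subst_congr {f g : X → Term X} (h : ∀ x, LDExpands (f x) (g x)) (t : Term X) :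
    LDExpands (subst f t) (subst g t) := by
  induction t using termInduction with
  | of x => exact h x
  | mul a b iha ihb => exact iha.mul ihb

theorem LDExpands.subst {f g : X → Term X} (h : ∀ x, LDExpands (f x) (g x)) {t t' : Term X}
    (ht : LDExpands t t') : LDExpands (subst f t) (subst g t') :=
  (Relation.ReflTransGen.lift (SelfDistrib.subst f) (fun _ _ h => LDStep.subst f h) _ _ ht).trans
    (subst_congr h t')

/-- A left factor can be distributed down to the leaves of the skeleton `t`. -/
theorem ldExpands_mul_subst (a : Term X) (f : X → Term X) (t : Term X) :
    LDExpands (a * subst f t) (subst (fun x => a * f x) t) := by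
  induction t using termInduction with
  | of x => exact .refl
  | mul b c ihb ihc => exact .head (.root _ _ _) (ihb.mul ihc)

/-- `dist a t` is the product `a * t` with `a` distributed down to all leaves of `t`. -/
def dist (a t : Term X) : Term X := subst (fun x => a * .of x) t

theorem subst_of_eq (t : Term X) : subst .of t = t := by
  induction t using termInduction with
  | of x => rfl
  | mul a b iha ihb => simp [iha, ihb]

theorem ldExpands_dist (a t : Term X) : LDExpands (a * t) (dist a t) := by
  have h := ldExpands_mul_subst a .of t
  rwa [subst_of_eq] at h

theorem LDExpands.dist {a a' t t' : Term X} (ha : LDExpands a a') (ht : LDExpands t t') :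
    LDExpands (dist a t) (dist a' t') :=
  LDExpands.subst (fun _ => ha.mul .refl) ht

theorem dist_dist (a b c : Term X) :
    dist a (dist b c) = subst (fun x => dist a b * (a * .of x)) c := by
  simp [dist, subst_subst]

/-- The derivative `∂t` of a term: an expansion of `t` that is also an expansion of every term
obtained from `t` by a single expansion step. -/
def derivative : Term X → Term X
  | .of x => .of x
  | .mul a b => dist (derivative a) (derivative b)

@[simp] theorem derivative_mul (a b : Term X) :
    derivative (a * b) = dist (derivative a) (derivative b) := rfl

theorem ldExpands_derivative (t : Term X) : LDExpands t (derivative t) := by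
  induction t using termInduction with
  | of x => exact .refl
  | mul a b iha ihb => exact (iha.mul ihb).trans (ldExpands_dist _ _)

theorem LDStep.ldExpands_derivative {t t' : Term X} (h : LDStep t t') :
    LDExpands t' (derivative t) := by
  induction h with
  | root a b c =>
    rw [derivative_mul, derivative_mul, dist_dist]
    refine .trans ?_ (ldExpands_mul_subst _ _ _)
    have key (d : Term X) : LDExpands (a * d) (SelfDistrib.dist (derivative a) (derivative d)) :=
      SelfDistrib.ldExpands_derivative (a * d)
    exact (key b).mul (key c)
  | left b _ ih => exact (ih.mul (SelfDistrib.ldExpands_derivative b)).trans (ldExpands_dist _ _)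
  | right a _ ih => exact ((SelfDistrib.ldExpands_derivative a).mul ih).trans (ldExpands_dist _ _)

theorem LDStep.derivative {t t' : Term X} (h : LDStep t t') :
    LDExpands (derivative t) (SelfDistrib.derivative t') := by
  induction h with
  | root a b c =>
    simp only [derivative_mul, dist_dist]
    refine LDExpands.subst_congr (fun x => ?_) _
    exact .head (.root _ _ _) ((ldExpands_dist _ _).mul .refl)
  | left b _ ih => exact ih.dist .refl
  | right a _ ih => exact LDExpands.dist .refl ih

theorem LDExpands.derivative {t t' : Term X} (h : LDExpands t t') :
    LDExpands (derivative t) (SelfDistrib.derivative t') := by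
  induction h with
  | refl => exact .refl
  | tail _ h ih => exact ih.trans h.derivative

/-- A single step and a sequence of expansions can be joined. The step is absorbed by a
derivative, which commutes with expansion. -/
theorem LDExpands.exists_join_step {t u v : Term X} (hu : LDExpands t u) (hv : LDStep t v) :
    ∃ w, LDExpands u w ∧ LDExpands v w :=
  ⟨SelfDistrib.derivative u, ldExpands_derivative u, hv.ldExpands_derivative.trans hu.derivative⟩

theorem LDExpands.confluent {t u v : Term X} (hu : LDExpands t u) (hv : LDExpands t v) :
    ∃ w, LDExpands u w ∧ LDExpands v w := by
  induction hv using Relation.ReflTransGen.head_induction_on generalizing u with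
  | refl => exact ⟨u, .refl, hu⟩
  | head h _ ih =>
    obtain ⟨w, hw, hw'⟩ := hu.exists_join_step h
    obtain ⟨z, hz, hz'⟩ := ih hw'
    exact ⟨z, hw.trans hz, hz'⟩

/-- The congruence of having a common expansion. -/
def joinCon (X : Type*) : Con (Term X) where
  r t t' := ∃ u, LDExpands t u ∧ LDExpands t' u
  iseqv :=
    { refl := fun t => ⟨t, .refl, .refl⟩
      symm := fun ⟨u, h, h'⟩ => ⟨u, h', h⟩
      trans := by
        rintro a b c ⟨u, hu, hu'⟩ ⟨v, hv, hv'⟩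
        obtain ⟨w, hw, hw'⟩ := hu'.confluent hv
        exact ⟨w, hu.trans hw, hv'.trans hw'⟩ }
  mul' := by
    rintro a b c d ⟨u, hu, hu'⟩ ⟨v, hv, hv'⟩
    exact ⟨u * v, hu.mul hv, hu'.mul hv'⟩

theorem exists_common_expansion {t t' : Term X} (h : ldCon X t t') :
    ∃ u, LDExpands t u ∧ LDExpands t' u := by
  have hle : ldCon X ≤ joinCon X := Con.conGen_le.2 (by
    rintro _ _ ⟨a, b, c⟩
    exact ⟨_, .single (.root a b c), .refl⟩)
  exact hle h

theorem LDStep.ldCon {t t' : Term X} (h : LDStep t t') : SelfDistrib.ldCon X t t' := by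
  induction h with
  | root a b c => exact ConGen.Rel.of _ _ ⟨a, b, c⟩
  | left b _ ih => exact (SelfDistrib.ldCon X).mul ih ((SelfDistrib.ldCon X).refl b)
  | right a _ ih => exact (SelfDistrib.ldCon X).mul ((SelfDistrib.ldCon X).refl a) ih

theorem LDExpands.ldCon {t t' : Term X} (h : LDExpands t t') : SelfDistrib.ldCon X t t' := by
  induction h with
  | refl => exact (SelfDistrib.ldCon X).refl _
  | tail _ h ih => exact (SelfDistrib.ldCon X).trans ih h.ldCon

/-! ### Iterated left subterms under expansion -/

theorem LDStep.exists_iterDivides {t s s' : Term X} (hs : LDStep s s') (h : Divides t s) :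
    ∃ t', Relation.ReflGen LDStep t t' ∧ IterDivides t' s' := by
  obtain ⟨x, hx⟩ := h
  cases hs with
  | root a b c =>
    obtain ⟨rfl, -⟩ := mul_injective hx
    exact ⟨t, .refl, .tail (.single ⟨b, rfl⟩) ⟨_, rfl⟩⟩
  | @left a a' b h =>
    obtain ⟨rfl, -⟩ := mul_injective hx
    exact ⟨a', .single h, .single ⟨b, rfl⟩⟩
  | @right a b b' h =>
    obtain ⟨rfl, -⟩ := mul_injective hx
    exact ⟨t, .refl, .single ⟨b', rfl⟩⟩

theorem IterDivides.exists_of_step {t s s' : Term X} (h : IterDivides t s) (hs : LDStep s s') :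
    ∃ t', Relation.ReflGen LDStep t t' ∧ IterDivides t' s' := by
  induction h using Relation.TransGen.head_induction_on with
  | single h => exact hs.exists_iterDivides h
  | head h hbc ih =>
    obtain ⟨b', hb, hb'⟩ := ih
    cases hb with
    | refl => exact ⟨_, .refl, .head h hb'⟩
    | single hb =>
      obtain ⟨t', ht, ht'⟩ := hb.exists_iterDivides h
      exact ⟨t', ht, ht'.trans hb'⟩

/-- Expanding a term expands its iterated left subterms. -/
theorem IterDivides.exists_of_expands {t s s' : Term X} (h : IterDivides t s)
    (hs : LDExpands s s') : ∃ t', LDExpands t t' ∧ IterDivides t' s' := by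
  induction hs with
  | refl => exact ⟨t, .refl, h⟩
  | tail _ hs ih =>
    obtain ⟨t₁, h₁, h₁'⟩ := ih
    obtain ⟨t₂, h₂, h₂'⟩ := h₁'.exists_of_step hs
    exact ⟨t₂, h₁.trans h₂.to_reflTransGen, h₂'⟩

theorem not_iterDivides_of (t : Term X) (x : X) : ¬ IterDivides t (.of x) := by
  intro h
  obtain ⟨c, -, y, hy⟩ := Relation.TransGen.tail'_iff.1 h
  cases hy

theorem iterDivides_mul {t a b : Term X} : IterDivides t (a * b) ↔ t = a ∨ IterDivides t a := by
  constructor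
  · intro h
    obtain ⟨c, hc, y, hy⟩ := Relation.TransGen.tail'_iff.1 h
    obtain ⟨rfl, -⟩ := mul_injective hy
    exact (Relation.reflTransGen_iff_eq_or_transGen.1 hc).imp_left Eq.symm
  · rintro (rfl | h)
    · exact .single ⟨b, rfl⟩
    · exact h.tail ⟨b, rfl⟩

theorem IterDivides.trichotomy {s t u : Term X} (hs : IterDivides s u) (ht : IterDivides t u) :
    s = t ∨ IterDivides s t ∨ IterDivides t s := by
  induction u using termInduction with
  | of x => exact absurd hs (not_iterDivides_of _ _)
  | mul a b iha _ =>
    rw [iterDivides_mul] at hs ht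
    rcases hs with rfl | hs <;> rcases ht with rfl | ht
    · exact .inl rfl
    · exact .inr (.inr ht)
    · exact .inr (.inl hs)
    · exact iha hs ht

end Expansion

/-! ### Comparison of terms in one variable -/

/-- The right powers of the variable: `x`, `x * x`, `x * (x * x)`, and so on. -/
def rightPower : ℕ → Term₁
  | 0 => .of ()
  | n + 1 => .of () * rightPower n

/-- Large right powers of the variable absorb every term on their left. -/
theorem exists_absorption (t : Term₁) :
    ∃ N, ∀ n ≥ N, ldCon Unit (t * rightPower n) (rightPower (n + 1)) := by
  induction t using termInduction with
  | of x => exact ⟨0, fun n _ => (ldCon Unit).refl _⟩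
  | mul a b iha ihb =>
    obtain ⟨M, hM⟩ := iha
    obtain ⟨N, hN⟩ := ihb
    refine ⟨M + N + 1, fun n hn => ?_⟩
    obtain ⟨k, rfl⟩ : ∃ k, n = k + 1 := ⟨n - 1, by omega⟩
    let r := ldCon Unit
    have h₁ : r (a * b * rightPower (k + 1)) (a * b * (a * rightPower k)) :=
      r.mul (r.refl _) (r.symm (hM k (by omega)))
    have h₂ : r (a * b * (a * rightPower k)) (a * (b * rightPower k)) :=
      r.symm (LDStep.root a b (rightPower k)).ldCon
    have h₃ : r (a * (b * rightPower k)) (a * rightPower (k + 1)) :=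
      r.mul (r.refl _) (hN k (by omega))
    exact r.trans h₁ (r.trans h₂ (r.trans h₃ (hM (k + 1) (by omega))))

/-- Both terms are, up to LD-equivalence, left factors of one right power; in a common expansion
of the two products, the two factors appear expanded on the same left branch. -/
theorem exists_comparable_expansions (t t' : Term₁) :
    ∃ u u', LDExpands t u ∧ LDExpands t' u' ∧ (u = u' ∨ IterDivides u u' ∨ IterDivides u' u) := by
  obtain ⟨N, hN⟩ := exists_absorption t
  obtain ⟨N', hN'⟩ := exists_absorption t'
  obtain ⟨w, hw, hw'⟩ := exists_common_expansion
    ((ldCon Unit).trans (hN (N + N') (by omega)) ((ldCon Unit).symm (hN' (N + N') (by omega))))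
  obtain ⟨u, hu, huw⟩ := IterDivides.exists_of_expands (.single ⟨_, rfl⟩) hw
  obtain ⟨u', hu', huw'⟩ := IterDivides.exists_of_expands (.single ⟨_, rfl⟩) hw'
  exact ⟨u, u', hu, hu', huw.trichotomy huw'⟩

/-! ### Selfdistributive operations from shifts on groups -/

/-- The operation `a, b ↦ a · sh b · σ · (sh a)⁻¹` attached to an endomorphism `sh` and an element
`σ` of a group. -/
def shiftOp {G : Type*} [Group G] (sh : G →* G) (σ a b : G) : G := a * sh b * σ * (sh a)⁻¹

theorem shiftOp_selfDistrib {G : Type*} [Group G] (sh : G →* G) (σ : G)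
    (hcomm : ∀ a, Commute σ (sh (sh a))) (hbraid : σ * sh σ * σ = sh σ * σ * sh σ) (a b c : G) :
    shiftOp sh σ a (shiftOp sh σ b c) =
      shiftOp sh σ (shiftOp sh σ a b) (shiftOp sh σ a c) := by
  have h₁ : σ * sh (sh c) = sh (sh c) * σ := hcomm c
  have h₂ : (sh (sh a))⁻¹ * σ = σ * (sh (sh a))⁻¹ := (hcomm a).symm.inv_left.eq
  have h₃ : (sh (sh b))⁻¹ * σ = σ * (sh (sh b))⁻¹ := (hcomm b).symm.inv_left.eq
  have h₄ : σ * sh σ * σ * (sh σ)⁻¹ = sh σ * σ := by rw [hbraid, mul_inv_cancel_right]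
  simp only [shiftOp, map_mul, map_inv, mul_inv_rev, inv_inv]
  calc a * (sh b * sh (sh c) * sh σ * (sh (sh b))⁻¹) * σ * (sh a)⁻¹
      = a * sh b * sh (sh c) * sh σ * ((sh (sh b))⁻¹ * σ) * (sh a)⁻¹ := by group
    _ = a * sh b * sh (sh c) * (sh σ * σ) * (sh (sh b))⁻¹ * (sh a)⁻¹ := by rw [h₃]; group
    _ = a * sh b * (sh (sh c) * σ) * sh σ * σ * (sh σ)⁻¹ * (sh (sh b))⁻¹ * (sh a)⁻¹ := by
        rw [← h₄]; group
    _ = a * sh b * σ * sh (sh c) * sh σ * (σ * (sh (sh a))⁻¹) * sh (sh a) * (sh σ)⁻¹ *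
          (sh (sh b))⁻¹ * (sh a)⁻¹ := by rw [← h₁]; group
    _ = _ := by rw [← h₂]; group

/-! ### First letters of reduced words in a free group -/

/-- The free group on countably many generators. -/
abbrev FreeGp := FreeGroup ℕ

/-- The element of the free group represented by a one-letter word: `(n, true)` stands for the
generator of index `n` and `(n, false)` for its inverse. -/
def letter (l : ℕ × Bool) : FreeGp := FreeGroup.mk [l]

/-- The reduced word of `g` begins with the letter `l`. -/
def StartsWith (l : ℕ × Bool) (g : FreeGp) : Prop := g.toWord.head? = some l

theorem toWord_letter_mul (l : ℕ × Bool) (g : FreeGp) :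
    (letter l * g).toWord =
      if g.toWord.head? = some (l.1, !l.2) then g.toWord.tail else l :: g.toWord := by
  obtain ⟨n, b⟩ := l
  have h : (letter (n, b) * g).toWord = FreeGroup.reduce ((n, b) :: g.toWord) := by
    rw [letter, FreeGroup.toWord_mul, FreeGroup.toWord_mk]
    simp
  rw [h, FreeGroup.reduce.cons, FreeGroup.reduce_toWord]
  rcases hw : g.toWord with _ | ⟨⟨m, c⟩, w⟩
  · simp
  · cases b <;> cases c <;> simp [eq_comm]

theorem StartsWith.not_of_ne {l m : ℕ × Bool} {g : FreeGp} (h : StartsWith l g) (hlm : l ≠ m) :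
    ¬ StartsWith m g := by
  intro h'
  exact hlm (Option.some.inj (h.symm.trans h'))

theorem not_startsWith_one (l : ℕ × Bool) : ¬ StartsWith l 1 := by
  simp [StartsWith]

theorem toWord_letter_mul_of_not {l : ℕ × Bool} {g : FreeGp} (h : ¬ StartsWith (l.1, !l.2) g) :
    (letter l * g).toWord = l :: g.toWord := by
  exact (toWord_letter_mul l g).trans (if_neg h)

theorem startsWith_letter_mul {l : ℕ × Bool} {g : FreeGp} (h : ¬ StartsWith (l.1, !l.2) g) :
    StartsWith l (letter l * g) := by
  rw [StartsWith, toWord_letter_mul_of_not h]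
  rfl

/-- Induction along reduced words, by adding letters on the left. -/
theorem reducedInduction {P : FreeGp → Prop} (one : P 1)
    (mul : ∀ l g, ¬ StartsWith (l.1, !l.2) g → P g → P (letter l * g)) (g : FreeGp) : P g := by
  generalize hw : g.toWord = w
  induction w generalizing g with
  | nil => rwa [FreeGroup.toWord_eq_nil_iff.1 hw]
  | cons l w ih =>
    have hred : FreeGroup.IsReduced (l :: w) := hw ▸ FreeGroup.isReduced_toWord
    have hw' : (FreeGroup.mk w).toWord = w := by
      rw [FreeGroup.toWord_mk]
      exact (FreeGroup.isReduced_iff_reduce_eq.1 (hred.tail))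
    have hg : g = letter l * FreeGroup.mk w := by
      rw [← FreeGroup.mk_toWord (x := g), hw, letter, FreeGroup.mul_mk]
      rfl
    rw [hg]
    refine mul l _ (fun h => ?_) (ih _ hw')
    rw [StartsWith, hw'] at h
    obtain ⟨w', rfl⟩ : ∃ w', w = (l.1, !l.2) :: w' := by
      cases w with
      | nil => simp at h
      | cons m w => exact ⟨w, by simpa using h⟩
    have := (FreeGroup.isReduced_cons_cons.1 hred).1 rfl
    simp at this

/-! ### The shift and the first braid generator -/

/-- The endomorphism of the free group that maps each generator to the next one. -/
def succHom : FreeGp →* FreeGp := FreeGroup.map Nat.succ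

theorem succHom_of (n : ℕ) : succHom (.of n) = .of (n + 1) := FreeGroup.map.of

/-- The endomorphism that fixes the generator of index `0` and acts as `f` on the others, once
their indices are shifted by one. -/
def shiftHom (f : FreeGp →* FreeGp) : FreeGp →* FreeGp :=
  FreeGroup.lift fun
    | 0 => .of 0
    | n + 1 => succHom (f (.of n))

@[simp] theorem shiftHom_zero (f : FreeGp →* FreeGp) : shiftHom f (.of 0) = .of 0 :=
  FreeGroup.lift_apply_of

@[simp] theorem shiftHom_succ (f : FreeGp →* FreeGp) (n : ℕ) :
    shiftHom f (.of (n + 1)) = succHom (f (.of n)) :=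
  FreeGroup.lift_apply_of

theorem shiftHom_succHom (f : FreeGp →* FreeGp) (g : FreeGp) :
    shiftHom f (succHom g) = succHom (f g) := by
  have h : (shiftHom f).comp succHom = succHom.comp f := by
    ext n
    simp [succHom_of]
  exact DFunLike.congr_fun h g

theorem shiftHom_comp (f g : FreeGp →* FreeGp) :
    (shiftHom f).comp (shiftHom g) = shiftHom (f.comp g) := by
  ext n
  cases n <;> simp [shiftHom_succHom]

theorem shiftHom_id : shiftHom (MonoidHom.id FreeGp) = MonoidHom.id FreeGp := by
  ext n
  cases n <;> simp [succHom_of]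

/-- The shift on automorphisms of the free group. -/
def shift : MulAut FreeGp →* MulAut FreeGp where
  toFun f := MonoidHom.toMulEquiv (shiftHom f.toMonoidHom) (shiftHom f.symm.toMonoidHom)
    (by rw [shiftHom_comp, ← shiftHom_id]; congr 1; ext; simp)
    (by rw [shiftHom_comp, ← shiftHom_id]; congr 1; ext; simp)
  map_one' := MulEquiv.toMonoidHom_injective shiftHom_id
  map_mul' f g := MulEquiv.toMonoidHom_injective
    (shiftHom_comp f.toMonoidHom g.toMonoidHom).symm

@[simp] theorem shift_zero (f : MulAut FreeGp) : shift f (.of 0) = .of 0 :=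
  shiftHom_zero f.toMonoidHom

@[simp] theorem shift_succ (f : MulAut FreeGp) (n : ℕ) :
    shift f (.of (n + 1)) = succHom (f (.of n)) :=
  shiftHom_succ f.toMonoidHom n

theorem shift_succHom (f : MulAut FreeGp) (g : FreeGp) :
    shift f (succHom g) = succHom (f g) :=
  shiftHom_succHom f.toMonoidHom g

/-- Artin's automorphism attached to the first braid generator. -/
def artin : MulAut FreeGp :=
  MonoidHom.toMulEquiv
    (FreeGroup.lift fun
      | 0 => .of 0 * .of 1 * (.of 0)⁻¹
      | 1 => .of 0
      | n + 2 => .of (n + 2))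
    (FreeGroup.lift fun
      | 0 => .of 1
      | 1 => (.of 1)⁻¹ * .of 0 * .of 1
      | n + 2 => .of (n + 2))
    (by ext n; rcases n with _ | _ | n <;> simp [mul_assoc])
    (by ext n; rcases n with _ | _ | n <;> simp [mul_assoc])

@[simp] theorem artin_zero : artin (.of 0) = .of 0 * .of 1 * (.of 0)⁻¹ := by
  simp [artin]

@[simp] theorem artin_one : artin (.of 1) = .of 0 := by simp [artin]

@[simp] theorem artin_add_two (n : ℕ) : artin (.of (n + 2)) = .of (n + 2) := by simp [artin]

theorem mulAut_ext {f g : MulAut FreeGp} (h : ∀ n, f (.of n) = g (.of n)) : f = g :=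
  MulEquiv.toMonoidHom_injective (FreeGroup.ext_hom _ _ h)

theorem artin_succHom_succHom (g : FreeGp) :
    artin (succHom (succHom g)) = succHom (succHom g) := by
  have h : artin.toMonoidHom.comp (succHom.comp succHom) = succHom.comp succHom := by
    ext n
    simp [succHom_of]
  exact DFunLike.congr_fun h g

theorem commute_artin_shift_shift (f : MulAut FreeGp) : Commute artin (shift (shift f)) := by
  refine mulAut_ext fun n => ?_
  have h1 : shift (shift f) (.of 1) = .of 1 := by
    rw [← zero_add 1, shift_succ, shift_zero, succHom_of]
  rcases n with _ | _ | n <;> simp [h1, artin_succHom_succHom]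

theorem artin_braid : artin * shift artin * artin = shift artin * artin * shift artin := by
  refine mulAut_ext fun n => ?_
  have h1 : shift artin (.of 1) = .of 1 * .of 2 * (.of 1)⁻¹ := by
    rw [← zero_add 1, shift_succ, artin_zero]
    simp [succHom_of]
  have h2 : shift artin (.of 2) = .of 1 := by
    rw [← one_add_one_eq_two, shift_succ, artin_one, succHom_of]
  have h3 (n : ℕ) : shift artin (.of (n + 3)) = .of (n + 3) := by
    rw [shift_succ, artin_add_two, succHom_of]
  have h4 (n : ℕ) : artin (.of (n + 3)) = .of (n + 3) := artin_add_two (n + 1)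
  have h5 : artin (.of 2) = .of 2 := artin_add_two 0
  rcases n with _ | _ | _ | n <;> simp [h1, h2, h3, h4, h5, mul_assoc]

/-! ### Automorphisms that preserve the first letter -/

theorem letter_true (n : ℕ) : letter (n, true) = .of n := rfl

theorem letter_false (n : ℕ) : letter (n, false) = (.of n)⁻¹ := rfl

theorem succHom_letter (n : ℕ) (b : Bool) : succHom (letter (n, b)) = letter (n + 1, b) := rfl

theorem shift_letter_zero (f : MulAut FreeGp) (b : Bool) :
    shift f (letter (0, b)) = letter (0, b) := by
  cases b <;> simp [letter_true, letter_false]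

/-- A nontrivial shifted factor determines the index of the first letter. -/
theorem startsWith_succHom_mul {g h : FreeGp} (hg : g ≠ 1)
    (hh : ∀ n b, ¬ StartsWith (n + 1, b) h) :
    ∃ n b, StartsWith (n + 1, b) (succHom g * h) := by
  have key : ∀ g : FreeGp, g = 1 ∨
      ∃ n b, StartsWith (n, b) g ∧ StartsWith (n + 1, b) (succHom g * h) := by
    intro g
    induction g using reducedInduction with
    | one => exact .inl rfl
    | mul l g hl ih =>
      obtain ⟨n, b⟩ := l
      refine .inr ⟨n, b, startsWith_letter_mul hl, ?_⟩
      rw [map_mul, succHom_letter, mul_assoc]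
      refine startsWith_letter_mul ?_
      rcases ih with rfl | ⟨m, c, hm, hm'⟩
      · simpa using hh n _
      · refine hm'.not_of_ne fun heq => hl ?_
        simp only [Prod.mk.injEq, Nat.add_right_cancel_iff] at heq
        rwa [← heq.1, ← heq.2]
  obtain h | ⟨n, b, -, h⟩ := key g
  · exact absurd h hg
  · exact ⟨n, b, h⟩

/-- A shifted automorphism acts on the blocks of letters of positive index, and it erases none of
them since it is injective. So it preserves the position of the letters of index `0`. -/
theorem StartsWith.shift (f : MulAut FreeGp) {b : Bool} {g : FreeGp} (hg : StartsWith (0, b) g) :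
    StartsWith (0, b) (shift f g) := by
  -- Split `g` before its first letter of index `0`.
  have key : ∀ g : FreeGp, ∃ u h, g = succHom u * h ∧
      (h = 1 ∨ ∃ b, StartsWith (0, b) h ∧ StartsWith (0, b) (SelfDistrib.shift f h)) := by
    intro g
    induction g using reducedInduction with
    | one => exact ⟨1, 1, by simp, .inl rfl⟩
    | mul l g hl ih =>
      obtain ⟨u, h, rfl, hh⟩ := ih
      obtain ⟨n | n, b⟩ := l
      · refine ⟨1, letter (0, b) * (succHom u * h), by simp, .inr ⟨b, startsWith_letter_mul hl, ?_⟩⟩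
        rw [map_mul, shift_letter_zero]
        refine startsWith_letter_mul ?_
        by_cases hu : u = 1
        · subst hu
          simp only [map_one, one_mul] at hl ⊢
          rcases hh with rfl | ⟨c, hc, hc'⟩
          · simpa using not_startsWith_one _
          · refine hc'.not_of_ne fun heq => hl ?_
            rwa [← heq]
        · rw [map_mul, shift_succHom]
          obtain ⟨n, c, hn⟩ := startsWith_succHom_mul (g := f u) (h := SelfDistrib.shift f h)
            (by simpa using hu) (fun n c => by
              rcases hh with rfl | ⟨c, -, hc'⟩
              · simpa using not_startsWith_one _
              · exact hc'.not_of_ne (by simp))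
          exact hn.not_of_ne (by simp)
      · exact ⟨letter (n, b) * u, h, by rw [map_mul, succHom_letter, mul_assoc], hh⟩
  obtain ⟨u, h, rfl, hh⟩ := key g
  by_cases hu : u = 1
  · subst hu
    simp only [map_one, one_mul] at hg ⊢
    rcases hh with rfl | ⟨c, hc, hc'⟩
    · exact absurd hg (not_startsWith_one _)
    · obtain rfl : b = c := by
        by_contra hbc
        exact hc.not_of_ne (by simpa [eq_comm] using hbc) hg
      exact hc'
  · obtain ⟨n, c, hn⟩ := startsWith_succHom_mul (h := h) hu (fun n c => by
      rcases hh with rfl | ⟨c, hc, -⟩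
      · exact not_startsWith_one _
      · exact hc.not_of_ne (by simp))
    exact absurd hg (hn.not_of_ne (by simp))

/-- What is known about the reduced word `w` of `artin g` when the reduced word of `g` begins with
the letter `l`. -/
def ArtinPattern : ℕ × Bool → List (ℕ × Bool) → Prop
  | (0, true), w => ∃ v, w = (0, true) :: (1, true) :: v
  | (0, false), w => ∃ v, w = (0, true) :: (1, false) :: v
  | (1, true), w => ∃ v, w = (0, true) :: v ∧ ∀ b, v.head? ≠ some (1, b)
  | (1, false), w => ∃ l v, w = l :: v ∧ (l = (0, false) ∨ ∃ b, l = (1, b))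
  | (n + 2, b), w => ∃ v, w = (n + 2, b) :: v

theorem artin_letter_zero (b : Bool) :
    artin (letter (0, b)) = letter (0, true) * letter (1, b) * letter (0, false) := by
  cases b <;> simp [letter_true, letter_false, mul_assoc]

theorem artin_letter_one (b : Bool) : artin (letter (1, b)) = letter (0, b) := by
  cases b <;> simp [letter_true, letter_false]

theorem artin_letter_add_two (n : ℕ) (b : Bool) :
    artin (letter (n + 2, b)) = letter (n + 2, b) := by
  cases b <;> simp [letter_true, letter_false]

/-- The patterns are maintained when a letter is added on the left of a reduced word: each letter
has its image multiplied on the left of a word of known beginning, and the cancellations never go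
beyond the known part. -/
theorem artinPattern (g : FreeGp) : g = 1 ∨
    ∃ l, StartsWith l g ∧ ArtinPattern l (artin g).toWord := by
  induction g using reducedInduction with
  | one => exact .inl rfl
  | mul l g hl ih =>
    refine .inr ⟨l, startsWith_letter_mul hl, ?_⟩
    have hm : (artin g).toWord = [] ∨ ∃ m, m ≠ (l.1, !l.2) ∧ ArtinPattern m (artin g).toWord := by
      rcases ih with rfl | ⟨m, hm, hm'⟩
      · simp
      · exact .inr ⟨m, fun h => hl (h ▸ hm), hm'⟩
    rw [map_mul]
    generalize artin g = k at hm
    obtain ⟨n, b⟩ := l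
    rcases n with _ | _ | n
    · rw [artin_letter_zero, mul_assoc, mul_assoc]
      rcases hm with hm | ⟨⟨_ | _ | m, c⟩, hne, hm⟩
      · cases b <;> simp [ArtinPattern, toWord_letter_mul, hm]
      · obtain rfl : c = b := by cases b <;> cases c <;> simp_all
        cases c <;> obtain ⟨v, hv⟩ := hm <;> simp [ArtinPattern, toWord_letter_mul, hv]
      · cases c
        · obtain ⟨l, v, hv, rfl | ⟨c, rfl⟩⟩ := hm <;> cases b <;>
            simp [ArtinPattern, toWord_letter_mul, hv]
        · obtain ⟨v, hv, hv'⟩ := hm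
          cases b <;> simp [ArtinPattern, toWord_letter_mul, hv, hv']
      · obtain ⟨v, hv⟩ := hm
        cases b <;> simp [ArtinPattern, toWord_letter_mul, hv]
    · rw [zero_add, artin_letter_one]
      rcases hm with hm | ⟨⟨_ | _ | m, c⟩, hne, hm⟩
      · cases b <;> simp [ArtinPattern, toWord_letter_mul, hm]
      · cases b <;> cases c <;> obtain ⟨v, hv⟩ := hm <;>
          simp [ArtinPattern, toWord_letter_mul, hv]
      · obtain rfl : c = b := by cases b <;> cases c <;> simp_all
        cases c
        · obtain ⟨l, v, hv, rfl | ⟨c, rfl⟩⟩ := hm <;> simp [ArtinPattern, toWord_letter_mul, hv]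
        · obtain ⟨v, hv, -⟩ := hm
          simp [ArtinPattern, toWord_letter_mul, hv]
      · obtain ⟨v, hv⟩ := hm
        cases b <;> simp [ArtinPattern, toWord_letter_mul, hv]
    · rw [artin_letter_add_two]
      rcases hm with hm | ⟨⟨_ | _ | m, c⟩, hne, hm⟩
      · simp [ArtinPattern, toWord_letter_mul, hm]
      · cases c <;> obtain ⟨v, hv⟩ := hm <;> simp [ArtinPattern, toWord_letter_mul, hv]
      · cases c
        · obtain ⟨l, v, hv, rfl | ⟨c, rfl⟩⟩ := hm <;> simp [ArtinPattern, toWord_letter_mul, hv]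
        · obtain ⟨v, hv, -⟩ := hm
          simp [ArtinPattern, toWord_letter_mul, hv]
      · obtain ⟨v, hv⟩ := hm
        have hne' : ¬ (m = n ∧ c = !b) := by simpa using hne
        simp [ArtinPattern, toWord_letter_mul, hv, hne']

theorem StartsWith.artin {g : FreeGp} (hg : StartsWith (0, true) g) :
    StartsWith (0, true) (artin g) := by
  obtain rfl | ⟨l, hl, hl'⟩ := artinPattern g
  · exact absurd hg (not_startsWith_one _)
  · obtain rfl : l = (0, true) := Option.some.inj (hl.symm.trans hg)
    obtain ⟨v, hv⟩ := hl'
    rw [StartsWith, hv]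
    rfl

/-! ### Acyclicity of left division -/

/-- Automorphisms that keep the words beginning with the generator of index `0` and that send the
inverse of that generator to such a word. -/
structure IsPositive (f : MulAut FreeGp) : Prop where
  map_startsWith : ∀ g, StartsWith (0, true) g → StartsWith (0, true) (f g)
  map_inv : StartsWith (0, true) (f (letter (0, false)))

theorem IsPositive.mul {f g : MulAut FreeGp} (hf : IsPositive f) (hg : IsPositive g) :
    IsPositive (f * g) :=
  ⟨fun _ h => hf.map_startsWith _ (hg.map_startsWith _ h), hf.map_startsWith _ hg.map_inv⟩

theorem IsPositive.ne_one {f : MulAut FreeGp} (hf : IsPositive f) : f ≠ 1 := by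
  rintro rfl
  have h := hf.map_inv
  simp [StartsWith, letter] at h

theorem isPositive_shift_mul_artin_mul_shift (f g : MulAut FreeGp) :
    IsPositive (shift f * artin * shift g) := by
  refine ⟨fun _ h => ((h.shift g).artin).shift f, ?_⟩
  refine StartsWith.shift f (g := artin (shift g (letter (0, false)))) ?_
  rw [shift_letter_zero, artin_letter_zero]
  simp [StartsWith, letter]

/-- The value of a term in the selfdistributive structure on automorphisms of the free group, the
variable being sent to the identity. -/
def braidValue : Term₁ → MulAut FreeGp
  | .of _ => 1
  | .mul a b => shiftOp shift artin (braidValue a) (braidValue b)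

theorem braidValue_mul (a b : Term₁) :
    braidValue (a * b) = shiftOp shift artin (braidValue a) (braidValue b) := rfl

theorem braidValue_eq_of_ldCon {t t' : Term₁} (h : ldCon Unit t t') :
    braidValue t = braidValue t' := by
  let c : Con Term₁ :=
    { r := fun t t' => braidValue t = braidValue t'
      iseqv := ⟨fun _ => rfl, Eq.symm, Eq.trans⟩
      mul' := fun h h' => by rw [braidValue_mul, braidValue_mul, h, h'] }
  have hle : ldCon Unit ≤ c := Con.conGen_le.2 (by
    rintro _ _ ⟨a, b, d⟩
    exact shiftOp_selfDistrib shift artin commute_artin_shift_shift artin_braid _ _ _)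
  exact hle h

/-- Each division step multiplies the value by a positive factor on the right. -/
theorem IterDivides.isPositive {t t' : Term₁} (h : IterDivides t t') :
    IsPositive ((braidValue t)⁻¹ * braidValue t') := by
  have step (t u : Term₁) : IsPositive ((braidValue t)⁻¹ * braidValue (t * u)) := by
    have h := isPositive_shift_mul_artin_mul_shift (braidValue u) (braidValue t)⁻¹
    rw [braidValue_mul, shiftOp]
    simpa [mul_assoc] using h
  induction h with
  | single h =>
    obtain ⟨u, rfl⟩ := h
    exact step _ u
  | @tail b _ _ h ih =>
    obtain ⟨u, rfl⟩ := h
    simpa [mul_assoc] using ih.mul (step b u)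

/-- No term is LD-equivalent to one of its proper iterated left subterms. -/
theorem IterDivides.not_ldCon {t t' : Term₁} (h : IterDivides t t') : ¬ ldCon Unit t t' := by
  intro h'
  apply h.isPositive.ne_one
  rw [braidValue_eq_of_ldCon h', inv_mul_cancel]

/-! ### Expansion along sequences of addresses -/

theorem exists_expandAt {X : Type*} {t t' : Term X} (h : LDStep t t') :
    ∃ α, expandAt α t = some t' := by
  induction h with
  | root a b c => exact ⟨[], rfl⟩
  | @left a a' b _ ih =>
    obtain ⟨α, hα⟩ := ih
    exact ⟨false :: α, (congrArg (Option.map fun u => u * b) hα :)⟩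
  | @right a b b' _ ih =>
    obtain ⟨α, hα⟩ := ih
    exact ⟨true :: α, (congrArg (Option.map fun u => a * u) hα :)⟩

theorem ldStep_of_expandAt {X : Type*} {α : Address} {t t' : Term X}
    (h : expandAt α t = some t') : LDStep t t' := by
  induction α generalizing t t' with
  | nil =>
    match t, h with
    | .mul a (.mul b c), h =>
      obtain rfl := Option.some.inj h
      exact .root a b c
  | cons d α ih =>
    match d, t, h with
    | false, .mul a b, h =>
      obtain ⟨u, hu, rfl⟩ := Option.map_eq_some_iff.1 h
      exact .left b (ih hu)
    | true, .mul a b, h =>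
      obtain ⟨u, hu, rfl⟩ := Option.map_eq_some_iff.1 h
      exact .right a (ih hu)

theorem expand_cons {X : Type*} (t : Term X) (α : Address) (s : List Address) :
    expand t (α :: s) = (expandAt α t).bind fun u => expand u s := rfl

theorem exists_expand {X : Type*} {t t' : Term X} (h : LDExpands t t') :
    ∃ s, expand t s = some t' := by
  induction h using Relation.ReflTransGen.head_induction_on with
  | refl => exact ⟨[], rfl⟩
  | head h _ ih =>
    obtain ⟨α, hα⟩ := exists_expandAt h
    obtain ⟨s, hs⟩ := ih
    exact ⟨α :: s, by rw [expand_cons, hα]; exact hs⟩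

theorem ldExpands_of_expand {X : Type*} {s : List Address} {t t' : Term X}
    (h : expand t s = some t') : LDExpands t t' := by
  induction s generalizing t with
  | nil =>
    obtain rfl := Option.some.inj h
    exact .refl
  | cons α s ih =>
    obtain ⟨u, hu, hu'⟩ := Option.bind_eq_some_iff.1 h
    exact .head (ldStep_of_expandAt hu) (ih hu')

theorem pass_eq_some_iff {t t' : Term₁} {p : List Address × List Address} {b : Bool} :
    pass t t' p = some b ↔ ∃ u u', expand t p.1 = some u ∧ expand t' p.2 = some u' ∧
      (if u = u' then some true
        else if IterDivides u u' ∨ IterDivides u' u then some false else none) = some b := by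
  rw [pass]
  cases expand t p.1 <;> cases expand t' p.2 <;> simp

/-- Every answer returned by a pass is right; the answer `false` is right by acyclicity. -/
theorem pass_sound {t t' : Term₁} {p : List Address × List Address} {b : Bool}
    (h : pass t t' p = some b) : b = true ↔ ldCon Unit t t' := by
  obtain ⟨u, u', hu, hu', hb⟩ := pass_eq_some_iff.1 h
  have hc := (ldExpands_of_expand hu).ldCon
  have hc' := (ldExpands_of_expand hu').ldCon
  let r := ldCon Unit
  split_ifs at hb with h₁ h₂
  · subst h₁
    simpa [← Option.some.inj hb] using r.trans hc (r.symm hc')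
  · obtain rfl := Option.some.inj hb
    simp only [Bool.false_eq_true, false_iff]
    intro h
    have huu' : r u u' := r.trans (r.symm hc) (r.trans h hc')
    rcases h₂ with h₂ | h₂
    · exact h₂.not_ldCon huu'
    · exact h₂.not_ldCon (r.symm huu')

theorem exists_pass_eq_some (t t' : Term₁) : ∃ p b, pass t t' p = some b := by
  obtain ⟨u, u', hu, hu', h⟩ := exists_comparable_expansions t t'
  obtain ⟨s, hs⟩ := exists_expand hu
  obtain ⟨s', hs'⟩ := exists_expand hu'
  refine ⟨(s, s'), decide (u = u'), pass_eq_some_iff.2 ⟨u, u', hs, hs', ?_⟩⟩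
  by_cases huu' : u = u'
  · simp [huu']
  · simp [huu', h.resolve_left huu']

theorem syntacticAlgorithm_correct {e : ℕ → List Address × List Address}
    (he : Function.Surjective e) (t t' : Term₁) :
    ∃ b ∈ syntacticAlgorithm e t t', (b = true ↔ ldCon Unit t t') := by
  obtain ⟨p, b, hb⟩ := exists_pass_eq_some t t'
  obtain ⟨n, rfl⟩ := he p
  have hdom : (syntacticAlgorithm e t t').Dom := Nat.rfindOpt_dom.2 ⟨n, b, hb⟩
  refine ⟨_, Part.get_mem hdom, ?_⟩
  obtain ⟨m, hm⟩ := Nat.rfindOpt_spec (Part.get_mem hdom)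
  exact pass_sound hm

/-! ### Primitive recursiveness of one pass -/

theorem primrec_termCode : Primrec termCode := Primrec.encode

theorem primrec_termDecode : Primrec termDecode :=
  Primrec.of_equiv_symm (e := ⟨termCode, termDecode, termDecode_termCode, termCode_termDecode⟩)

theorem termCode_mul (a b : Term₁) :
    termCode (a * b) = Nat.pair (termCode a) (termCode b) + 1 := rfl

theorem primrec_mul : Primrec₂ fun a b : Term₁ => a * b := by
  have h : Primrec₂ fun a b : Term₁ =>
      termDecode (Nat.pair (termCode a) (termCode b) + 1) :=
    primrec_termDecode.comp (Primrec.succ.comp (Primrec₂.natPair.comp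
      (primrec_termCode.comp Primrec.fst) (primrec_termCode.comp Primrec.snd)))
  refine h.of_eq fun a b => ?_
  rw [← termCode_mul, termDecode_termCode]

/-- The two factors of a product. -/
def factors : Term₁ → Option (Term₁ × Term₁)
  | .of _ => none
  | .mul a b => some (a, b)

theorem primrec_factors : Primrec factors := by
  have h : Primrec fun t : Term₁ => (Nat.casesOn (termCode t) none fun m =>
      some (termDecode m.unpair.1, termDecode m.unpair.2) : Option (Term₁ × Term₁)) :=
    Primrec.nat_casesOn primrec_termCode (Primrec.const none)
      (Primrec.option_some.comp (Primrec.pair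
        (primrec_termDecode.comp (Primrec.fst.comp (Primrec.unpair.comp Primrec.snd)))
        (primrec_termDecode.comp (Primrec.snd.comp (Primrec.unpair.comp Primrec.snd)))))
  refine h.of_eq fun t => ?_
  cases t with
  | of x => rfl
  | mul a b => simp [termCode, factors, termDecode_termCode]

/-- The law LD applied once at the root. -/
def expandRoot (t : Term₁) : Option Term₁ :=
  (factors t).bind fun p => (factors p.2).map fun q => (p.1 * q.1) * (p.1 * q.2)

theorem primrec_expandRoot : Primrec expandRoot := by
  refine Primrec.option_bind primrec_factors ?_
  refine Primrec.option_map (primrec_factors.comp (Primrec.snd.comp Primrec.snd)) ?_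
  have h : Primrec fun x : (Term₁ × (Term₁ × Term₁)) × (Term₁ × Term₁) => x.1.2.1 :=
    Primrec.fst.comp (Primrec.snd.comp Primrec.fst)
  exact primrec_mul.comp (primrec_mul.comp h (Primrec.fst.comp Primrec.snd))
    (primrec_mul.comp h (Primrec.snd.comp Primrec.snd))

/-- A subterm together with its context: the directions taken on the way down, the last one first,
each with the factor left aside. -/
abbrev Zipper := Term₁ × List (Bool × Term₁)

/-- Move a zipper one step down. -/
def descend (z : Zipper) (d : Bool) : Option Zipper :=
  (factors z.1).map fun p => bif d then (p.2, (true, p.1) :: z.2) else (p.1, (false, p.2) :: z.2)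

/-- Undo one step down. -/
def ascend (t : Term₁) (c : Bool × Term₁) : Term₁ := bif c.1 then c.2 * t else t * c.2

theorem primrec_descend : Primrec₂ descend := by
  refine Primrec.option_map (primrec_factors.comp (Primrec.fst.comp Primrec.fst)) ?_
  have hd : Primrec fun x : (Zipper × Bool) × (Term₁ × Term₁) => x.1.2 :=
    Primrec.snd.comp Primrec.fst
  have hz : Primrec fun x : (Zipper × Bool) × (Term₁ × Term₁) => x.1.1.2 :=
    Primrec.snd.comp (Primrec.fst.comp Primrec.fst)
  have h₁ : Primrec fun x : (Zipper × Bool) × (Term₁ × Term₁) => x.2.1 :=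
    Primrec.fst.comp Primrec.snd
  have h₂ : Primrec fun x : (Zipper × Bool) × (Term₁ × Term₁) => x.2.2 :=
    Primrec.snd.comp Primrec.snd
  exact Primrec.cond hd
    (h₂.pair (Primrec.list_cons.comp ((Primrec.const true).pair h₁) hz))
    (h₁.pair (Primrec.list_cons.comp ((Primrec.const false).pair h₂) hz))

theorem primrec_ascend : Primrec₂ ascend := by
  have h : Primrec fun x : Term₁ × (Bool × Term₁) => x.2.2 := Primrec.snd.comp Primrec.snd
  exact Primrec.cond (Primrec.fst.comp Primrec.snd) (primrec_mul.comp h Primrec.fst)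
    (primrec_mul.comp Primrec.fst h)

theorem foldlM_option_eq_foldl {σ β : Type*} (f : σ → β → Option σ) (l : List β) (o : Option σ) :
    (o.bind fun s => l.foldlM f s) = l.foldl (fun o b => o.bind fun s => f s b) o := by
  induction l generalizing o with
  | nil => cases o <;> rfl
  | cons b l ih =>
    rw [List.foldl_cons, ← ih]
    cases o <;> rfl

theorem primrec_foldlM_option {α β σ : Type*} [Primcodable α] [Primcodable β] [Primcodable σ]
    {f : α → List β} {g : α → σ} {h : σ → β → Option σ} (hf : Primrec f) (hg : Primrec g)
    (hh : Primrec₂ h) : Primrec fun a => (f a).foldlM h (g a) := by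
  have hstep : Primrec₂ fun (_ : α) (p : Option σ × β) => p.1.bind fun s => h s p.2 :=
    Primrec.option_bind (Primrec.fst.comp Primrec.snd)
      (hh.comp Primrec.snd (Primrec.snd.comp (Primrec.snd.comp Primrec.fst)))
  refine (Primrec.list_foldl hf (Primrec.option_some.comp hg) hstep).of_eq fun a => ?_
  exact (foldlM_option_eq_foldl h (f a) (some (g a))).symm

/-- To expand at an address: go down, expand at the root, go up. -/
theorem expandAt_eq_zipper (α : Address) (t : Term₁) (c : List (Bool × Term₁)) :
    ((α.foldlM descend (t, c)).bind fun z => (expandRoot z.1).map fun u => z.2.foldl ascend u) =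
      (expandAt α t).map fun u => c.foldl ascend u := by
  induction α generalizing t c with
  | nil =>
    match t with
    | .of _ => rfl
    | .mul _ (.of _) => rfl
    | .mul _ (.mul _ _) => rfl
  | cons d α ih =>
    match d, t with
    | true, .of _ => rfl
    | false, .of _ => rfl
    | false, .mul a b =>
      refine (ih a ((false, b) :: c)).trans ?_
      rw [expandAt, Option.map_map]
      rfl
    | true, .mul a b =>
      refine (ih b ((true, a) :: c)).trans ?_
      rw [expandAt, Option.map_map]
      rfl

theorem primrec_expandAt : Primrec₂ fun (t : Term₁) (α : Address) => expandAt α t := by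
  have h : Primrec₂ fun (t : Term₁) (α : Address) =>
      (α.foldlM descend (t, [])).bind fun z => (expandRoot z.1).map fun u => z.2.foldl ascend u := by
    refine Primrec.option_bind (primrec_foldlM_option Primrec.snd
      (Primrec.fst.pair (Primrec.const [])) primrec_descend) ?_
    refine Primrec.option_map (primrec_expandRoot.comp (Primrec.fst.comp Primrec.snd)) ?_
    exact Primrec.list_foldl (h := fun _ p => ascend p.1 p.2)
      (Primrec.snd.comp (Primrec.snd.comp Primrec.fst)) Primrec.snd
      (primrec_ascend.comp (Primrec.fst.comp Primrec.snd) (Primrec.snd.comp Primrec.snd))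
  refine h.of_eq fun t α => ?_
  rw [expandAt_eq_zipper]
  simp

theorem primrec_expand : Primrec₂ fun (t : Term₁) (s : List Address) => expand t s :=
  primrec_foldlM_option Primrec.snd Primrec.fst primrec_expandAt

/-- Course-of-values recursion on the code of the second term. -/
theorem primrec_iterDividesTest : Primrec₂ fun s t : Term₁ => iterDividesTest s t := by
  let g : Term₁ → List Bool → Option Bool := fun s l =>
    Nat.casesOn l.length (some false) fun m =>
      (l[m.unpair.1]?).map fun r => decide (s = termDecode m.unpair.1) || r
  have hg : Primrec₂ g := by
    refine Primrec.nat_casesOn (Primrec.list_length.comp Primrec.snd) (Primrec.const _) ?_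
    have hm : Primrec fun x : (Term₁ × List Bool) × ℕ => x.2.unpair.1 :=
      Primrec.fst.comp (Primrec.unpair.comp Primrec.snd)
    refine Primrec.option_map (Primrec.list_getElem?.comp (Primrec.snd.comp Primrec.fst) hm) ?_
    refine Primrec.or.comp ?_ Primrec.snd
    exact (Primrec.eq (α := Term₁)).decide.comp (Primrec.fst.comp (Primrec.fst.comp Primrec.fst))
      (primrec_termDecode.comp (hm.comp Primrec.fst))
  have h : Primrec₂ fun (s : Term₁) (n : ℕ) => iterDividesTest s (termDecode n) := by
    refine Primrec.nat_strong_rec _ hg fun s n => ?_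
    cases n with
    | zero => simp [g, termDecode, iterDividesTest]
    | succ n =>
      have hn : n.unpair.1 < n + 1 := Nat.lt_succ_of_le (Nat.unpair_left_le n)
      have hmul : iterDividesTest s (termDecode (n + 1)) =
          (decide (s = termDecode n.unpair.1) || iterDividesTest s (termDecode n.unpair.1)) := by
        rw [termDecode]
        rfl
      rw [hmul]
      simp [g, hn]
  refine (h.comp Primrec.fst (primrec_termCode.comp Primrec.snd)).of_eq fun p => ?_
  rw [termDecode_termCode]

theorem primrecRel_iterDivides : PrimrecRel fun s t : Term₁ => IterDivides s t :=
  ⟨inferInstance, Primrec.of_eq primrec_iterDividesTest fun p => by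
    rw [Bool.eq_iff_iff, iterDividesTest_iff, decide_eq_true_iff]⟩

theorem primrec_pass :
    Primrec₂ fun (q : Term₁ × Term₁) (p : List Address × List Address) => pass q.1 q.2 p := by
  have h : Primrec₂ fun (q : Term₁ × Term₁) (p : List Address × List Address) =>
      (expand q.1 p.1).bind fun u => (expand q.2 p.2).bind fun u' =>
        if u = u' then some true
        else if IterDivides u u' ∨ IterDivides u' u then some false else none := by
    refine Primrec.option_bind (primrec_expand.comp (Primrec.fst.comp Primrec.fst)
      (Primrec.fst.comp Primrec.snd)) ?_
    refine Primrec.option_bind (primrec_expand.comp (Primrec.snd.comp (Primrec.fst.comp Primrec.fst))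
      (Primrec.snd.comp (Primrec.snd.comp Primrec.fst))) ?_
    let I := (((Term₁ × Term₁) × (List Address × List Address)) × Term₁) × Term₁
    have hu : Primrec fun x : I => x.1.2 := Primrec.snd.comp Primrec.fst
    have hu' : Primrec fun x : I => x.2 := Primrec.snd
    exact Primrec.ite (Primrec.eq.comp hu hu') (Primrec.const _)
      (Primrec.ite ((primrecRel_iterDivides.comp hu hu').or (primrecRel_iterDivides.comp hu' hu))
        (Primrec.const _) (Primrec.const _))
  refine h.of_eq fun q p => ?_
  rw [pass]
  cases expand q.1 p.1 <;> cases expand q.2 p.2 <;> rfl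

theorem partrec_syntacticAlgorithm {e : ℕ → List Address × List Address} (he : Computable e) :
    Partrec₂ (syntacticAlgorithm e) :=
  Partrec.rfindOpt (f := fun (q : Term₁ × Term₁) n => pass q.1 q.2 (e n))
    (primrec_pass.to_comp.comp Computable.fst (he.comp Computable.snd))

theorem exists_computable_surjective (α : Type*) [Primcodable α] [Inhabited α] :
    ∃ e : ℕ → α, Computable e ∧ Function.Surjective e := by
  refine ⟨fun n => (Encodable.decode n).getD default,
    (Primrec.option_getD.comp Primrec.decode (Primrec.const _)).to_comp,
    fun a => ⟨Encodable.encode a, ?_⟩⟩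
  simp

theorem computablePred_ldCon : ComputablePred fun p : Term₁ × Term₁ => ldCon Unit p.1 p.2 := by
  classical
  obtain ⟨e, he, he'⟩ := exists_computable_surjective (List Address × List Address)
  refine ⟨inferInstance, (partrec_syntacticAlgorithm he).of_eq fun p => ?_⟩
  obtain ⟨b, hb, hb'⟩ := syntacticAlgorithm_correct he' p.1 p.2
  have h : b = decide (ldCon Unit p.1 p.2) := by
    rw [Bool.eq_iff_iff, hb', decide_eq_true_iff]
  exact (Part.eq_some_iff.2 hb).trans (congrArg Part.some h)

end SelfDistrib

/-- The syntactic algorithm is correct (for every exhaustive enumeration it terminates on every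
input with the right answer, and it is effective if the enumeration is), and the word problem of
left selfdistributivity is decidable in the case of one variable. -/
theorem mainTheorem1 :
    (∀ e : ℕ → List SelfDistrib.Address × List SelfDistrib.Address, Function.Surjective e →
      ∀ t t' : SelfDistrib.Term₁,
        ∃ b ∈ SelfDistrib.syntacticAlgorithm e t t', (b = true ↔ SelfDistrib.ldCon Unit t t')) ∧
    (∀ e : ℕ → List SelfDistrib.Address × List SelfDistrib.Address, Computable e →
      Partrec₂ (SelfDistrib.syntacticAlgorithm e)) ∧
    ComputablePred
      (fun p : SelfDistrib.Term₁ × SelfDistrib.Term₁ => SelfDistrib.ldCon Unit p.1 p.2) :=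
  ⟨fun _ he => SelfDistrib.syntacticAlgorithm_correct he,
    fun _ he => SelfDistrib.partrec_syntacticAlgorithm he, SelfDistrib.computablePred_ldCon⟩
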